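/- \textbf{The language.} Types are $\sigma ::= \mathtt{unit} \mid \mathtt{bool} \mid \sigma_1\to\sigma_2$; the base types are $\mathtt{unit}$ and $\mathtt{bool}$. Expressions of Boolean PCF with exceptions (call-by-value, one exception constructor $\mathsf{Exc}_\sigma$ for each type $\sigma$) are $$M ::= \mathtt{fail} \mid V \mid x \mid M_1M_2 \mid \mathbf{Y}(\lambda f.\lambda x.M) \mid \mathtt{if}\ M_0\ \mathtt{then}\ M_1\ \mathtt{else}\ M_2 \mid \mathtt{raise}\ \mathsf{Exc}_\sigma\,M \mid \mathtt{try}\ M_1\ \mathtt{with}\ \mathsf{Exc}_\sigma\,x\to M_2,$$ with values $V ::= () \mid \mathtt{true} \mid \mathtt{false} \mid \lambda x.M$. Typing is the usual simple typing, where $\mathbf{Y}(\lambda f.\lambda x.M):\sigma_1\to\sigma_2$ if $M:\sigma_2$ under $f:\sigma_1\to\sigma_2$, $x:\sigma_1$; $\mathtt{fail}$ has every type; $\mathtt{raise}\ \mathsf{Exc}_\sigma\,M$ has every type if $M:\sigma$; and $\mathtt{try}\ M_1\ \mathtt{with}\ \mathsf{Exc}_\sigma\,x\to M_2$ has type $\tau$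 if $M_1:\tau$ and $M_2:\tau$ under $x:\sigma$. With evaluation contexts $$E ::= [\,] \mid E\,M \mid V\,E \mid \mathtt{if}\ E\ \mathtt{then}\ M_1\ \mathtt{else}\ M_2 \mid \mathtt{raise}\ \mathsf{Exc}_\sigma\,E \mid \mathtt{try}\ E\ \mathtt{with}\ \mathsf{Exc}_\sigma\,x\to M,$$ the reduction rules are $$E[(\lambda x.M)V]\to E[[V/x]M],\qquad E[\mathtt{fail}]\to\mathtt{fail},$$ $$E[\mathtt{if}\ \mathtt{true}\ \mathtt{then}\ M_1\ \mathtt{else}\ M_2]\to E[M_1],\qquad E[\mathtt{if}\ \mathtt{false}\ \mathtt{then}\ M_1\ \mathtt{else}\ M_2]\to E[M_2],$$ $$E[\mathbf{Y}(\lambda f.\lambda x.M)]\to E[\lambda x.[\mathbf{Y}(\lambda f.\lambda x.M)/f]M],$$ $$E[\mathtt{try}\ E'[\mathtt{raise}\ \mathsf{Exc}_\sigma\,V]\ \mathtt{with}\ \mathsf{Exc}_\sigma\,x\to M]\to E[[V/x]M],$$ the last one provided that the hole of $E'$ is not in the body of a handler for the same $\mathsf{Exc}_\sigma$ inside $E'$.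 Optionally there is also the rule $E[\mathtt{try}\ V\ \mathtt{with}\ \mathsf{Exc}_\sigma\,x\to M]\to E[V]$ for handlers whose body has become a value. The \emph{reachability problem} is: given a closed expression $M$ of base type, decide whether $M\to^*\mathtt{fail}$. \textbf{Theorem.} The reachability problem for Boolean PCF with exceptions is undecidable. It remains undecidable when it is restricted to expressions in which the only exception constructor that occurs is $\mathsf{Exc}_{\mathtt{unit}\to\mathtt{unit}}$. Both statements hold without and with the optional rule. -/

import Mathlib

namespace BPCF

/-! ### Types and expressions -/

/-- Simple types `σ ::= unit | bool | σ₁ → σ₂`. -/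
inductive Ty : Type
  | unit : Ty
  | bool : Ty
  | arr : Ty → Ty → Ty

/-- The base types are `unit` and `bool`. -/
def Ty.IsBase : Ty → Prop
  | .unit => True
  | .bool => True
  | .arr _ _ => False

/-- Expressions of Boolean PCF with exceptions, up to renaming of bound variables (de Bruijn
indices: `var 0` refers to the innermost binder). There is one exception constructor for each type,
so that the type itself serves as its name. -/
inductive Tm : Type
  /-- the error command -/
  | fail : Tm
  /-- the value `()` -/
  | unit : Tm
  /-- the value `true` -/
  | tt : Tm
  /-- the value `false` -/
  | ff : Tm
  | var : ℕ → Tm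
  /-- `λ x. M`; `x` is index `0` in `M` -/
  | lam : Tm → Tm
  | app : Tm → Tm → Tm
  /-- `Y (λ f. λ x. M)`; in `M`, `x` is index `0` and `f` is index `1` -/
  | fix : Tm → Tm
  | ite : Tm → Tm → Tm → Tm
  /-- `raise σ M`: raise the exception of type `σ` carrying the value of `M` -/
  | raise : Ty → Tm → Tm
  /-- `handle σ M N` is `try M with Exc_σ x → N`; `x` is index `0` in `N` -/
  | handle : Ty → Tm → Tm → Tm

/-- Values `V ::= () | true | false | λ x. M`. -/
def Tm.IsValue : Tm → Prop
  | .unit => True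
  | .tt => True
  | .ff => True
  | .lam _ => True
  | _ => False

/-! ### Typing -/

/-- The typing judgement `Γ ⊢ M : τ`; the `n`-th entry of `Γ` is the type of `var n`. -/
inductive HasTy : List Ty → Tm → Ty → Prop
  | fail (Γ : List Ty) (τ : Ty) : HasTy Γ .fail τ
  | unit (Γ : List Ty) : HasTy Γ .unit .unit
  | tt (Γ : List Ty) : HasTy Γ .tt .bool
  | ff (Γ : List Ty) : HasTy Γ .ff .bool
  | var (Γ : List Ty) (n : ℕ) (τ : Ty) (h : Γ[n]? = some τ) : HasTy Γ (.var n) τ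
  | lam (Γ : List Ty) (σ τ : Ty) (M : Tm) (h : HasTy (σ :: Γ) M τ) :
      HasTy Γ (.lam M) (.arr σ τ)
  | app (Γ : List Ty) (σ τ : Ty) (M N : Tm) (hM : HasTy Γ M (.arr σ τ)) (hN : HasTy Γ N σ) :
      HasTy Γ (.app M N) τ
  | fix (Γ : List Ty) (σ τ : Ty) (M : Tm) (h : HasTy (σ :: .arr σ τ :: Γ) M τ) :
      HasTy Γ (.fix M) (.arr σ τ)
  | ite (Γ : List Ty) (τ : Ty) (L M N : Tm) (hL : HasTy Γ L .bool) (hM : HasTy Γ M τ)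
      (hN : HasTy Γ N τ) : HasTy Γ (.ite L M N) τ
  | raise (Γ : List Ty) (σ τ : Ty) (M : Tm) (h : HasTy Γ M σ) : HasTy Γ (.raise σ M) τ
  | handle (Γ : List Ty) (σ τ : Ty) (M N : Tm) (hM : HasTy Γ M τ) (hN : HasTy (σ :: Γ) N τ) :
      HasTy Γ (.handle σ M N) τ

/-! ### Capture-avoiding substitution -/

/-- Extend a renaming under one binder. -/
def liftRen (ρ : ℕ → ℕ) : ℕ → ℕ
  | 0 => 0
  | n + 1 => ρ n + 1

/-- Rename the free variables of an expression. -/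
def Tm.rename : (ℕ → ℕ) → Tm → Tm
  | _, .fail => .fail
  | _, .unit => .unit
  | _, .tt => .tt
  | _, .ff => .ff
  | ρ, .var n => .var (ρ n)
  | ρ, .lam M => .lam (M.rename (liftRen ρ))
  | ρ, .app M N => .app (M.rename ρ) (N.rename ρ)
  | ρ, .fix M => .fix (M.rename (liftRen (liftRen ρ)))
  | ρ, .ite L M N => .ite (L.rename ρ) (M.rename ρ) (N.rename ρ)
  | ρ, .raise σ M => .raise σ (M.rename ρ)
  | ρ, .handle σ M N => .handle σ (M.rename ρ) (N.rename (liftRen ρ))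

/-- Extend a simultaneous substitution under one binder. -/
def liftSub (s : ℕ → Tm) : ℕ → Tm
  | 0 => .var 0
  | n + 1 => (s n).rename Nat.succ

/-- Simultaneous capture-avoiding substitution. -/
def Tm.subst : (ℕ → Tm) → Tm → Tm
  | _, .fail => .fail
  | _, .unit => .unit
  | _, .tt => .tt
  | _, .ff => .ff
  | s, .var n => s n
  | s, .lam M => .lam (M.subst (liftSub s))
  | s, .app M N => .app (M.subst s) (N.subst s)
  | s, .fix M => .fix (M.subst (liftSub (liftSub s)))
  | s, .ite L M N => .ite (L.subst s) (M.subst s) (N.subst s)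
  | s, .raise σ M => .raise σ (M.subst s)
  | s, .handle σ M N => .handle σ (M.subst s) (N.subst (liftSub s))

/-- The substitution that replaces index `0` by `V` and lowers all other indices by one. -/
def single (V : Tm) : ℕ → Tm
  | 0 => V
  | n + 1 => .var n

/-- `[V/x]M`, where `x` is index `0` of `M`. -/
def Tm.inst (M V : Tm) : Tm := M.subst (single V)

/-! ### Reduction semantics -/

/-- Evaluation contexts
`E ::= [] | E M | V E | if E M N | raise σ E | try E with Exc_σ x → N`. -/
inductive ECtx : Type
  | hole : ECtx
  | appL : ECtx → Tm → ECtx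
  | appR (V : Tm) : V.IsValue → ECtx → ECtx
  | ite : ECtx → Tm → Tm → ECtx
  | raise : Ty → ECtx → ECtx
  | handle : Ty → ECtx → Tm → ECtx

/-- `E.plug M` is `E[M]`. -/
def ECtx.plug : ECtx → Tm → Tm
  | .hole, L => L
  | .appL E N, L => .app (E.plug L) N
  | .appR V _ E, L => .app V (E.plug L)
  | .ite E M N, L => .ite (E.plug L) M N
  | .raise σ E, L => .raise σ (E.plug L)
  | .handle σ E N, L => .handle σ (E.plug L) N

/-- `E.Handles σ`: the context `E` has a part of the form `try E' with Exc_σ x → N`, where `E'` is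
an evaluation context, that is, the hole of `E` is in the scope of a handler for `Exc_σ`. -/
def ECtx.Handles (σ : Ty) : ECtx → Prop
  | .hole => False
  | .appL E _ => E.Handles σ
  | .appR _ _ E => E.Handles σ
  | .ite E _ _ => E.Handles σ
  | .raise _ E => E.Handles σ
  | .handle τ E _ => τ = σ ∨ E.Handles σ

/-- One-step reduction. The parameter `ret` tells whether the rule
`E[try V with Exc_σ x → N] ⟶ E[V]` for a handler whose body has become a value belongs to the
relation. All other rules are always there. -/
inductive Step (ret : Bool) : Tm → Tm → Prop
  | beta (E : ECtx) (M V : Tm) (hV : V.IsValue) :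
      Step ret (E.plug (.app (.lam M) V)) (E.plug (M.inst V))
  | iteTrue (E : ECtx) (M N : Tm) : Step ret (E.plug (.ite .tt M N)) (E.plug M)
  | iteFalse (E : ECtx) (M N : Tm) : Step ret (E.plug (.ite .ff M N)) (E.plug N)
  | fail (E : ECtx) : Step ret (E.plug .fail) .fail
  | unfold (E : ECtx) (M : Tm) :
      Step ret (E.plug (.fix M)) (E.plug (.lam (M.subst (liftSub (single (.fix M))))))
  | catchExc (E E' : ECtx) (σ : Ty) (V N : Tm) (hV : V.IsValue) (hE' : ¬ E'.Handles σ) :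
      Step ret (E.plug (.handle σ (E'.plug (.raise σ V)) N)) (E.plug (N.inst V))
  | handleValue (E : ECtx) (σ : Ty) (V N : Tm) (hV : V.IsValue) (hret : ret = true) :
      Step ret (E.plug (.handle σ V N)) (E.plug V)

/-- `M ⟶* fail`. -/
def ReachesFail (ret : Bool) (M : Tm) : Prop :=
  Relation.ReflTransGen (Step ret) M .fail

/-- The inputs of the reachability problem: closed expressions of base type. -/
def IsProgram (M : Tm) : Prop :=
  ∃ b : Ty, b.IsBase ∧ HasTy [] M b

/-- Every exception constructor that occurs in the expression (in a `raise` or in a handler) is the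
one of type `σ`. -/
def Tm.OnlyExc (σ : Ty) : Tm → Prop
  | .fail => True
  | .unit => True
  | .tt => True
  | .ff => True
  | .var _ => True
  | .lam M => M.OnlyExc σ
  | .app M N => M.OnlyExc σ ∧ N.OnlyExc σ
  | .fix M => M.OnlyExc σ
  | .ite L M N => L.OnlyExc σ ∧ M.OnlyExc σ ∧ N.OnlyExc σ
  | .raise τ M => τ = σ ∧ M.OnlyExc σ
  | .handle τ M N => τ = σ ∧ M.OnlyExc σ ∧ N.OnlyExc σ

/-! ### Gödel numbering of expressions, so that algorithms on expressions make sense -/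

/-- The number of a type. -/
def Ty.code : Ty → ℕ
  | .unit => 0
  | .bool => 1
  | .arr σ τ => Nat.pair σ.code τ.code + 2

/-- The type with a given number. -/
def Ty.ofCode : ℕ → Ty
  | 0 => .unit
  | 1 => .bool
  | n + 2 =>
    have : n.unpair.1 < n + 2 := lt_of_le_of_lt n.unpair_left_le (by omega)
    have : n.unpair.2 < n + 2 := lt_of_le_of_lt n.unpair_right_le (by omega)
    .arr (Ty.ofCode n.unpair.1) (Ty.ofCode n.unpair.2)

theorem Ty.ofCode_code (σ : Ty) : Ty.ofCode σ.code = σ := by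
  induction σ with
  | unit => simp [Ty.code, Ty.ofCode]
  | bool => simp [Ty.code, Ty.ofCode]
  | arr σ τ h₁ h₂ => simp [Ty.code, Ty.ofCode, h₁, h₂]

theorem Ty.code_ofCode (n : ℕ) : (Ty.ofCode n).code = n := by
  induction n using Nat.strong_induction_on with
  | _ n ih =>
    match n with
    | 0 => simp [Ty.code, Ty.ofCode]
    | 1 => simp [Ty.code, Ty.ofCode]
    | n + 2 =>
      have h₁ := ih n.unpair.1 (lt_of_le_of_lt n.unpair_left_le (by omega))
      have h₂ := ih n.unpair.2 (lt_of_le_of_lt n.unpair_right_le (by omega))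
      simp [Ty.code, Ty.ofCode, h₁, h₂]

/-- The number of an expression. -/
def Tm.code : Tm → ℕ
  | .fail => 0
  | .unit => 1
  | .tt => 2
  | .ff => 3
  | .var n => 7 * n + 4
  | .lam M => 7 * M.code + 5
  | .app M N => 7 * Nat.pair M.code N.code + 6
  | .fix M => 7 * M.code + 7
  | .ite L M N => 7 * Nat.pair L.code (Nat.pair M.code N.code) + 8
  | .raise σ M => 7 * Nat.pair σ.code M.code + 9
  | .handle σ M N => 7 * Nat.pair σ.code (Nat.pair M.code N.code) + 10

/-- The expression with a given number. -/
def Tm.ofCode : ℕ → Tm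
  | 0 => .fail
  | 1 => .unit
  | 2 => .tt
  | 3 => .ff
  | n + 4 =>
    let k := n / 7
    have h0 : k < n + 4 := by omega
    have h1 : k.unpair.1 < n + 4 := lt_of_le_of_lt k.unpair_left_le h0
    have h2 : k.unpair.2 < n + 4 := lt_of_le_of_lt k.unpair_right_le h0
    have h21 : k.unpair.2.unpair.1 < n + 4 := lt_of_le_of_lt (Nat.unpair_left_le _) h2
    have h22 : k.unpair.2.unpair.2 < n + 4 := lt_of_le_of_lt (Nat.unpair_right_le _) h2
    match n % 7 with
    | 0 => .var k
    | 1 => .lam (Tm.ofCode k)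
    | 2 => .app (Tm.ofCode k.unpair.1) (Tm.ofCode k.unpair.2)
    | 3 => .fix (Tm.ofCode k)
    | 4 => .ite (Tm.ofCode k.unpair.1) (Tm.ofCode k.unpair.2.unpair.1)
        (Tm.ofCode k.unpair.2.unpair.2)
    | 5 => .raise (Ty.ofCode k.unpair.1) (Tm.ofCode k.unpair.2)
    | _ => .handle (Ty.ofCode k.unpair.1) (Tm.ofCode k.unpair.2.unpair.1)
        (Tm.ofCode k.unpair.2.unpair.2)
termination_by n => n
decreasing_by all_goals assumption

theorem Tm.ofCode_code (M : Tm) : Tm.ofCode M.code = M := by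
  have key : ∀ k r : ℕ, r < 7 → (7 * k + r) / 7 = k ∧ (7 * k + r) % 7 = r := by
    intro k r hr; omega
  induction M with
  | fail => simp [Tm.code, Tm.ofCode]
  | unit => simp [Tm.code, Tm.ofCode]
  | tt => simp [Tm.code, Tm.ofCode]
  | ff => simp [Tm.code, Tm.ofCode]
  | var n =>
    rw [Tm.code, Tm.ofCode]
    simp
  | lam M h =>
    rw [Tm.code, show 7 * M.code + 5 = (7 * M.code + 1) + 4 from rfl, Tm.ofCode]
    obtain ⟨h₁, h₂⟩ := key M.code 1 (by omega)
    simp [h₁, h₂, h]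
  | app M N hM hN =>
    rw [Tm.code, show ∀ a, 7 * a + 6 = (7 * a + 2) + 4 from fun _ => rfl, Tm.ofCode]
    obtain ⟨h₁, h₂⟩ := key (Nat.pair M.code N.code) 2 (by omega)
    simp [h₁, h₂, hM, hN]
  | fix M h =>
    rw [Tm.code, show 7 * M.code + 7 = (7 * M.code + 3) + 4 from rfl, Tm.ofCode]
    obtain ⟨h₁, h₂⟩ := key M.code 3 (by omega)
    simp [h₁, h₂, h]
  | ite L M N hL hM hN =>
    rw [Tm.code, show ∀ a, 7 * a + 8 = (7 * a + 4) + 4 from fun _ => rfl, Tm.ofCode]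
    obtain ⟨h₁, h₂⟩ := key (Nat.pair L.code (Nat.pair M.code N.code)) 4 (by omega)
    simp [h₁, h₂, hL, hM, hN]
  | raise σ M hM =>
    rw [Tm.code, show ∀ a, 7 * a + 9 = (7 * a + 5) + 4 from fun _ => rfl, Tm.ofCode]
    obtain ⟨h₁, h₂⟩ := key (Nat.pair σ.code M.code) 5 (by omega)
    simp [h₁, h₂, hM, Ty.ofCode_code]
  | handle σ M N hM hN =>
    rw [Tm.code, show ∀ a, 7 * a + 10 = (7 * a + 6) + 4 from fun _ => rfl, Tm.ofCode]
    obtain ⟨h₁, h₂⟩ := key (Nat.pair σ.code (Nat.pair M.code N.code)) 6 (by omega)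
    simp [h₁, h₂, hM, hN, Ty.ofCode_code]

theorem Tm.code_ofCode (n : ℕ) : (Tm.ofCode n).code = n := by
  induction n using Nat.strong_induction_on with
  | _ n ih =>
    match n with
    | 0 => simp [Tm.code, Tm.ofCode]
    | 1 => simp [Tm.code, Tm.ofCode]
    | 2 => simp [Tm.code, Tm.ofCode]
    | 3 => simp [Tm.code, Tm.ofCode]
    | n + 4 =>
      have h0 : n / 7 < n + 4 := by omega
      have h1 : (n / 7).unpair.1 < n + 4 := lt_of_le_of_lt (Nat.unpair_left_le _) h0
      have h2 : (n / 7).unpair.2 < n + 4 := lt_of_le_of_lt (Nat.unpair_right_le _) h0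
      have h21 : (n / 7).unpair.2.unpair.1 < n + 4 := lt_of_le_of_lt (Nat.unpair_left_le _) h2
      have h22 : (n / 7).unpair.2.unpair.2 < n + 4 := lt_of_le_of_lt (Nat.unpair_right_le _) h2
      have e0 := ih _ h0
      have e1 := ih _ h1
      have e2 := ih _ h2
      have e21 := ih _ h21
      have e22 := ih _ h22
      have hr : n % 7 < 7 := Nat.mod_lt _ (by norm_num)
      have hd := Nat.div_add_mod n 7
      rw [Tm.ofCode]
      generalize n % 7 = r at hr hd
      interval_cases r <;>
        simp only [Tm.code, e0, e1, e2, e21, e22, Ty.code_ofCode, Nat.pair_unpair] <;> omega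

/-- The Gödel numbering of expressions is a bijection. -/
def Tm.equivNat : Tm ≃ ℕ where
  toFun := Tm.code
  invFun := Tm.ofCode
  left_inv := Tm.ofCode_code
  right_inv := Tm.code_ofCode

/-- Computability on expressions refers to this numbering. -/
instance : Denumerable Tm := Denumerable.mk' Tm.equivNat

/-- The decision problem with set of instances `D` and question `R` is decidable: some algorithm
answers `R` correctly on every instance in `D` (on other inputs its answer is irrelevant). -/
def DecidableProblem {α : Type} [Primcodable α] (D R : α → Prop) : Prop :=
  ∃ p : α → Prop, ComputablePred p ∧ ∀ a, D a → (p a ↔ R a)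

end BPCF

/-!
The exceptions carry functions of type `unit → unit`, and this type is rich enough to represent all
natural numbers: `0` is `λ x. ()`, and `n + 1` is `λ x. raise n`, so that calling a number inside a
handler reveals its predecessor. Together with `Y` this gives all primitive recursive functions,
written in continuation-passing style: without the optional rule a handler whose body has returned
never goes away, so that a computation cannot return its result but has to pass it on from below a
pile of idle handlers. These are harmless, since an exception is caught by the innermost handler.

A partial recursive program halts if and only if its evaluation succeeds within some number of
steps, and evaluation with a bound on the number of steps is primitive recursive. The expression
that tries all bounds one after another, and calls `fail` on the first success, hence reaches `fail`
exactly if the program halts. If there is no success, reduction visits infinitely many stages of the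
search, and since reduction is deterministic there is no other way to `fail`.
-/

namespace BPCF

open Relation (ReflTransGen TransGen)

/-! ### Determinism of reduction -/

/-- What an expression does next: it is a value, it reduces to `fail`, it is an uncaught exception
with a value as its argument, it takes any other step, or it is stuck. -/
inductive Outcome : Type
  | value : Outcome
  | fails : Outcome
  | raises : Ty → Tm → Outcome
  | steps : Tm → Outcome
  | stuck : Outcome

/-- The one-step reduct that an outcome announces, if any. -/
def Outcome.reduct : Outcome → Option Tm
  | .fails => some .fail
  | .steps M => some M
  | _ => none

/-- The outcome of an expression `C M` from the outcome of its subexpression `M` in evaluation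
position; `onValue` is the outcome of the whole if `M` is a value. -/
def Outcome.within : Outcome → (Tm → Tm) → Outcome → Outcome
  | .value, _, onValue => onValue
  | .steps M, C, _ => .steps (C M)
  | r, _, _ => r

/-- The outcome of the application of a value to a value. -/
def Tm.applyOutcome : Tm → Tm → Outcome
  | .lam M, V => .steps (M.inst V)
  | _, _ => .stuck

/-- The outcome of a conditional on a value. -/
def Tm.iteOutcome : Tm → Tm → Tm → Outcome
  | .tt, M, _ => .steps M
  | .ff, _, N => .steps N
  | _, _, _ => .stuck

open Classical in
/-- The outcome of `C M`, where `C` is a handler `try [] with Exc_σ x → N`, from the outcome of `M`;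
`onValue` is as in `Outcome.within`. -/
noncomputable def Outcome.handled :
    Outcome → (Tm → Tm) → Outcome → Ty → Tm → Outcome
  | .raises τ V, _, _, σ, N => if τ = σ then .steps (N.inst V) else .raises τ V
  | r, C, onValue, _, _ => r.within C onValue

/-- The outcome of an expression, by recursion on its structure rather than by a search for a redex
in an evaluation context. -/
noncomputable def Tm.outcome (ret : Bool) : Tm → Outcome
  | .fail => .fails
  | .unit => .value
  | .tt => .value
  | .ff => .value
  | .lam _ => .value
  | .var _ => .stuck
  | .fix M => .steps (.lam (M.subst (liftSub (single (.fix M)))))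
  | .app M N => (M.outcome ret).within (fun M' => .app M' N)
      ((N.outcome ret).within (fun N' => .app M N') (M.applyOutcome N))
  | .ite L M N => (L.outcome ret).within (fun L' => .ite L' M N) (L.iteOutcome M N)
  | .raise σ M => (M.outcome ret).within (fun M' => .raise σ M') (.raises σ M)
  | .handle σ M N => (M.outcome ret).handled (fun M' => .handle σ M' N)
      (if ret then .steps M else .stuck) σ N

variable {ret : Bool} {L M N V : Tm}

theorem Tm.IsValue.outcome_eq (hV : V.IsValue) : V.outcome ret = .value := by
  cases V <;> first | rfl | exact hV.elim

theorem ECtx.outcome_plug_of_steps (E : ECtx) (h : M.outcome ret = .steps N) :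
    (E.plug M).outcome ret = .steps (E.plug N) := by
  induction E with
  | hole => exact h
  | appR V hV E ih => simp [ECtx.plug, Tm.outcome, ih, hV.outcome_eq, Outcome.within]
  | _ => simp_all [ECtx.plug, Tm.outcome, Outcome.within, Outcome.handled]

theorem ECtx.outcome_plug_fail (E : ECtx) : (E.plug .fail).outcome ret = .fails := by
  induction E with
  | hole => rfl
  | appR V hV E ih => simp [ECtx.plug, Tm.outcome, ih, hV.outcome_eq, Outcome.within]
  | _ => simp_all [ECtx.plug, Tm.outcome, Outcome.within, Outcome.handled]

theorem ECtx.outcome_plug_raise (E : ECtx) {σ : Ty} (hV : V.IsValue) (hE : ¬ E.Handles σ) :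
    (E.plug (.raise σ V)).outcome ret = .raises σ V := by
  induction E with
  | hole => simp [ECtx.plug, Tm.outcome, hV.outcome_eq, Outcome.within]
  | appR W hW E ih => simp [ECtx.plug, Tm.outcome, ih hE, hW.outcome_eq, Outcome.within]
  | handle τ E N ih =>
    simp only [ECtx.Handles, not_or] at hE
    simp [ECtx.plug, Tm.outcome, ih hE.2, Outcome.handled, Ne.symm hE.1]
  | _ => simp_all [ECtx.plug, ECtx.Handles, Tm.outcome, Outcome.within]

theorem Step.reduct_outcome (h : Step ret M N) : (M.outcome ret).reduct = some N := by
  have of_steps (E : ECtx) {M N : Tm} (h : M.outcome ret = .steps N) :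
      ((E.plug M).outcome ret).reduct = some (E.plug N) := by
    rw [E.outcome_plug_of_steps h, Outcome.reduct]
  cases h with
  | fail E => rw [E.outcome_plug_fail, Outcome.reduct]
  | unfold E M => exact of_steps E rfl
  | iteTrue E M N => exact of_steps E rfl
  | iteFalse E M N => exact of_steps E rfl
  | beta E M V hV =>
    exact of_steps E (by simp [Tm.outcome, Outcome.within, hV.outcome_eq, Tm.applyOutcome])
  | catchExc E E' σ V N hV hE' =>
    exact of_steps E (by simp [Tm.outcome, Outcome.handled, E'.outcome_plug_raise hV hE'])
  | handleValue E σ V N hV hret =>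
    exact of_steps E
      (by simp [Tm.outcome, Outcome.handled, Outcome.within, hV.outcome_eq, hret])

theorem step_rightUnique : Relator.RightUnique (Step ret) :=
  fun _ _ _ h h' => Option.some_injective _ (h.reduct_outcome.symm.trans h'.reduct_outcome)

theorem eq_fail_of_reflTransGen (h : ReflTransGen (Step ret) .fail N) : N = .fail := by
  induction h with
  | refl => rfl
  | tail _ hs ih =>
    subst ih
    exact (Option.some_injective _ hs.reduct_outcome).symm

theorem exists_reflTransGen_of_progress {α : Type*} {r : α → α → Prop}
    (hr : Relator.RightUnique r) {P : α → Prop} (hP : ∀ x, P x → ∃ y, P y ∧ TransGen r x y)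
    {x z : α} (hx : P x) (hxz : ReflTransGen r x z) : ∃ y, P y ∧ ReflTransGen r z y := by
  induction hxz with
  | refl => exact ⟨x, hx, .refl⟩
  | tail _ huv ih =>
    obtain ⟨y, hy, huy⟩ := ih
    obtain ⟨y', hy', hyy'⟩ := hP y hy
    obtain ⟨v, huv', hvy'⟩ := TransGen.head'_iff.1 (TransGen.trans_right huy hyy')
    exact ⟨y', hy', hr huv huv' ▸ hvy'⟩

/-! ### Reduction inside evaluation contexts -/

/-- Composition of evaluation contexts: `(E.comp C)[M] = E[C[M]]`. -/
def ECtx.comp : ECtx → ECtx → ECtx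
  | .hole, C => C
  | .appL E N, C => .appL (E.comp C) N
  | .appR V h E, C => .appR V h (E.comp C)
  | .ite E M N, C => .ite (E.comp C) M N
  | .raise σ E, C => .raise σ (E.comp C)
  | .handle σ E N, C => .handle σ (E.comp C) N

theorem ECtx.plug_comp (E C : ECtx) (M : Tm) : (E.comp C).plug M = E.plug (C.plug M) := by
  induction E <;> simp_all [ECtx.plug, ECtx.comp]

theorem ECtx.eq_fail_of_plug_eq_fail {E : ECtx} (h : E.plug M = .fail) : M = .fail := by
  cases E <;> first | exact h | cases h

/-- Application is written as juxtaposition: `M N` is `Tm.app M N`. -/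
instance : CoeFun Tm fun _ => Tm → Tm := ⟨Tm.app⟩

/-- `M` reduces to `N` in every evaluation context, in at least one step. -/
def Run (ret : Bool) (M N : Tm) : Prop :=
  ∀ E : ECtx, TransGen (Step ret) (E.plug M) (E.plug N)

/-- In every evaluation context, `M` reduces to `C[N]` in at least one step, for some evaluation
context `C`. This context consists of the handlers that are left over, when the optional reduction
rule is missing, from computations that have returned. -/
def Yields (ret : Bool) (M N : Tm) : Prop :=
  ∃ C : ECtx, Run ret M (C.plug N)

theorem Run.trans (h : Run ret L M) (h' : Run ret M N) : Run ret L N :=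
  fun E => (h E).trans (h' E)

theorem Run.plug (h : Run ret M N) (C : ECtx) : Run ret (C.plug M) (C.plug N) := fun E => by
  simpa only [ECtx.plug_comp] using h (E.comp C)

theorem Run.appL (h : Run ret M N) (L : Tm) : Run ret (M L) (N L) :=
  h.plug (.appL .hole L)

theorem Run.beta (hV : V.IsValue) (h : M.inst V = N) : Run ret (Tm.lam M V) N :=
  fun E => h ▸ .single (.beta E M V hV)

theorem Run.beta₂ {W : Tm} (hV : V.IsValue) (hW : W.IsValue)
    (h : (M.subst (liftSub (single V))).inst W = N) : Run ret (Tm.lam (.lam M) V W) N :=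
  ((Run.beta hV rfl).appL W).trans (.beta hW h)

theorem Run.beta₃ {W X : Tm} (hV : V.IsValue) (hW : W.IsValue) (hX : X.IsValue)
    (h : ((M.subst (liftSub (liftSub (single V)))).subst (liftSub (single W))).inst X = N) :
    Run ret (Tm.lam (.lam (.lam M)) V W X) N :=
  ((Run.beta₂ hV hW rfl).appL X).trans (.beta hX h)

theorem Run.unfold (h : .fix M = N) : Run ret N (.lam (M.subst (liftSub (single N)))) :=
  fun E => h ▸ .single (.unfold E M)

theorem Run.yields (h : Run ret M N) : Yields ret M N := ⟨.hole, h⟩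

theorem Yields.trans (h : Yields ret L M) (h' : Yields ret M N) : Yields ret L N := by
  obtain ⟨C, h⟩ := h
  obtain ⟨C', h'⟩ := h'
  exact ⟨C.comp C', by simpa only [ECtx.plug_comp] using h.trans (h'.plug C)⟩

theorem Yields.reachesFail (h : Yields ret M .fail) : ReachesFail ret M :=
  let ⟨C, hC⟩ := h
  (hC .hole).to_reflTransGen.tail (.fail C)

instance : Trans (Run ret) (Run ret) (Run ret) := ⟨Run.trans⟩

instance : Trans (Run ret) (Yields ret) (Yields ret) := ⟨fun h h' => h.yields.trans h'⟩

instance : Trans (Yields ret) (Run ret) (Yields ret) := ⟨fun h h' => h.trans h'.yields⟩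

instance : Trans (Yields ret) (Yields ret) (Yields ret) := ⟨Yields.trans⟩

/-! ### Closed expressions -/

/-- An expression is closed if no substitution affects it. -/
def Tm.Closed (M : Tm) : Prop := ∀ s, M.subst s = M

theorem Tm.rename_eq_subst (M : Tm) (ρ : ℕ → ℕ) : M.rename ρ = M.subst fun n => .var (ρ n) := by
  have liftRen_eq (ρ : ℕ → ℕ) :
      (fun n => Tm.var (liftRen ρ n)) = liftSub fun n => .var (ρ n) := by
    funext n
    cases n <;> rfl
  induction M generalizing ρ <;> simp_all only [Tm.rename, Tm.subst]

theorem Tm.Closed.subst_eq (hM : M.Closed) (s : ℕ → Tm) : M.subst s = M := hM s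

theorem Tm.Closed.rename_eq (hM : M.Closed) (ρ : ℕ → ℕ) : M.rename ρ = M :=
  (M.rename_eq_subst ρ).trans (hM _)

theorem liftSub_eq_var {k : ℕ} {s : ℕ → Tm} (hs : ∀ n < k, s n = .var n) :
    ∀ n < k + 1, liftSub s n = .var n
  | 0, _ => rfl
  | n + 1, hn => by simp only [liftSub, hs n (Nat.lt_of_succ_lt_succ hn), Tm.rename]

theorem HasTy.subst_eq_self {Γ : List Ty} {τ : Ty} (h : HasTy Γ M τ) {s : ℕ → Tm}
    (hs : ∀ n < Γ.length, s n = .var n) : M.subst s = M := by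
  induction h generalizing s with
  | var Γ n τ h => exact hs n (List.getElem?_eq_some_iff.1 h).1
  | lam _ _ _ _ _ ih => simp only [Tm.subst, ih (liftSub_eq_var hs)]
  | fix _ _ _ _ _ ih => simp only [Tm.subst, ih (liftSub_eq_var (liftSub_eq_var hs))]
  | handle _ _ _ _ _ _ _ ihM ihN => simp only [Tm.subst, ihM hs, ihN (liftSub_eq_var hs)]
  | _ => simp_all [Tm.subst]

theorem HasTy.closed {τ : Ty} (h : HasTy [] M τ) : M.Closed :=
  fun _ => h.subst_eq_self fun _ hn => absurd hn (Nat.not_lt_zero _)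

theorem HasTy.append {Γ : List Ty} {τ : Ty} (h : HasTy Γ M τ) (Δ : List Ty) :
    HasTy (Γ ++ Δ) M τ := by
  induction h with
  | var Γ n τ h =>
    exact .var _ _ _ ((List.getElem?_append_left (List.getElem?_eq_some_iff.1 h).1).trans h)
  | _ => constructor <;> assumption

theorem HasTy.weaken {τ : Ty} (h : HasTy [] M τ) (Γ : List Ty) : HasTy Γ M τ := h.append Γ

attribute [local simp] Tm.inst Tm.subst Tm.rename single liftSub

/-! ### Representation of data -/

/-- The type of the representatives of natural numbers; exceptions carry values of this type. -/
def natTy : Ty := .arr .unit .unit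

/-- The representative of a natural number: a function that returns if the number is `0`, and
raises the predecessor otherwise. -/
def num : ℕ → Tm
  | 0 => .lam .unit
  | n + 1 => .lam (.raise natTy (num n))

theorem num_isValue (n : ℕ) : (num n).IsValue := by cases n <;> trivial

theorem num_hasTy (n : ℕ) (Γ : List Ty) : HasTy Γ (num n) natTy := by
  induction n generalizing Γ with
  | zero => exact .lam _ _ _ _ (.unit _)
  | succ n ih => exact .lam _ _ _ _ (.raise _ _ _ _ (ih _))

theorem num_onlyExc (n : ℕ) : (num n).OnlyExc natTy := by
  induction n with
  | zero => trivial
  | succ n ih => exact ⟨rfl, ih⟩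

/-- A representation of the elements of `α` by closed values of type `Represented.ty α`. -/
class Represented (α : Type*) where
  ty (α) : Ty
  tm : α → Tm
  isValue (a : α) : (tm a).IsValue
  hasTy (a : α) : HasTy [] (tm a) ty
  onlyExc (a : α) : (tm a).OnlyExc natTy

namespace Represented

variable {α β : Type*} [Represented α]

@[simp]
theorem subst_tm (a : α) (s : ℕ → Tm) : (tm a).subst s = tm a := (hasTy a).closed.subst_eq s

@[simp]
theorem rename_tm (a : α) (ρ : ℕ → ℕ) : (tm a).rename ρ = tm a := (hasTy a).closed.rename_eq ρ

instance nat : Represented ℕ where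
  ty := natTy
  tm := num
  isValue := num_isValue
  hasTy n := num_hasTy n []
  onlyExc := num_onlyExc

theorem tm_succ (n : ℕ) : tm (n + 1) = .lam (.raise natTy (tm n)) := rfl

/-- A pair is represented by the function that passes both components to its argument. The result
type `unit` suffices, since all programs are written in continuation-passing style. -/
instance prod [Represented β] : Represented (α × β) where
  ty := .arr (.arr (ty α) (.arr (ty β) .unit)) .unit
  tm p := .lam (Tm.var 0 (tm p.1) (tm p.2))
  isValue _ := trivial
  hasTy p := .lam _ _ _ _ <| .app _ _ _ _ _
    (.app _ _ _ _ _ (.var _ _ _ rfl) ((hasTy p.1).weaken _)) ((hasTy p.2).weaken _)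
  onlyExc p := ⟨⟨trivial, onlyExc p.1⟩, onlyExc p.2⟩

theorem tm_prod [Represented β] (p : α × β) : tm p = .lam (Tm.var 0 (tm p.1) (tm p.2)) := rfl

/-- The elements of `β` are represented as their images under a function to `α`. -/
abbrev comap (f : β → α) : Represented β where
  ty := ty α
  tm b := tm (f b)
  isValue b := isValue (f b)
  hasTy b := hasTy (f b)
  onlyExc b := onlyExc (f b)

/-- Vectors are represented as iterated pairs. -/
instance vector : ∀ n, Represented (List.Vector ℕ n)
  | 0 => ⟨.unit, fun _ => .unit, fun _ => trivial, fun _ => .unit _, fun _ => trivial⟩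
  | n + 1 =>
    have := vector n
    comap (α := ℕ × List.Vector ℕ n) fun v => (v.head, v.tail)

end Represented

open Represented

/-- Case analysis on the natural number represented by `d`. Both branches are under a binder, which
is a dummy in the branch `M` for zero, and the predecessor in the branch `N` for successors. -/
def Tm.caseNat (d M N : Tm) : Tm := .handle natTy (Tm.lam M (d .unit)) N

@[simp]
theorem Tm.subst_caseNat (d M N : Tm) (s : ℕ → Tm) : (d.caseNat M N).subst s =
    (d.subst s).caseNat (M.subst (liftSub s)) (N.subst (liftSub s)) := rfl

theorem HasTy.caseNat {Γ : List Ty} {τ : Ty} {d : Tm} (hd : HasTy Γ d natTy)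
    (hM : HasTy (.unit :: Γ) M τ) (hN : HasTy (natTy :: Γ) N τ) : HasTy Γ (d.caseNat M N) τ :=
  .handle _ _ _ _ _ (.app _ _ _ _ _ (.lam _ _ _ _ hM) (.app _ _ _ _ _ hd (.unit _))) hN

@[simp]
theorem Tm.onlyExc_caseNat (d M N : Tm) :
    (d.caseNat M N).OnlyExc natTy ↔ d.OnlyExc natTy ∧ M.OnlyExc natTy ∧ N.OnlyExc natTy := by
  simp only [Tm.caseNat, Tm.OnlyExc]
  tauto

theorem Yields.caseNat_zero (h : M.inst .unit = L) : Yields ret ((tm 0).caseNat M N) L :=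
  have apply_tm : Run ret (tm 0 .unit) .unit := .beta trivial rfl
  ⟨.handle natTy .hole N,
    ((apply_tm.plug (.appR (.lam M) trivial .hole)).trans (.beta trivial h)).plug
      (.handle natTy .hole N)⟩

theorem Run.caseNat_succ (n : ℕ) (h : N.inst (tm n) = L) :
    Run ret ((tm (n + 1)).caseNat M N) L := by
  have apply_tm : Run ret (tm (n + 1) .unit) (.raise natTy (tm n)) :=
    .beta trivial (congrArg (Tm.raise natTy) (subst_tm n _))
  refine (apply_tm.plug (.handle natTy (.appR (.lam M) trivial .hole) N)).trans fun E => h ▸ ?_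
  exact .single (.catchExc E (.appR (.lam M) trivial .hole) natTy (tm n) N (isValue n) id)

/-! ### Definable functions -/

variable {α β γ : Type*} [Represented α] [Represented β] [Represented γ]

/-- `T` computes the function `f` in continuation-passing style: applied to the representative of
`a` and to a continuation, it calls the continuation with the representative of `f a`. -/
structure Computes (ret : Bool) (T : Tm) (f : α → β) : Prop where
  hasTy : HasTy [] T (.arr (ty α) (.arr (.arr (ty β) .unit) .unit))
  onlyExc : T.OnlyExc natTy
  yields (a : α) {k : Tm} (hk : k.IsValue) (hkc : k.Closed) :
    Yields ret (T (tm a) k) (k (tm (f a)))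

/-- Some expression computes the function `f` in continuation-passing style. -/
def Definable (ret : Bool) (f : α → β) : Prop := ∃ T, Computes ret T f

theorem Computes.closed {T : Tm} {f : α → β} (hT : Computes ret T f) : T.Closed := hT.hasTy.closed

/-- The function `iterate n b k := case n of 0 → k b | m + 1 → G b (λ b'. iterate m b' k)`, which
computes the iterates of the function computed by `G`. -/
def iterateTm (G : Tm) : Tm :=
  .fix (.lam (.lam ((Tm.var 2).caseNat (Tm.var 1 (.var 2))
    (G (.var 2) (.lam (Tm.var 5 (.var 1) (.var 0) (.var 2)))))))

theorem hasTy_iterateTm {G : Tm} {τ : Ty}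
    (hG : HasTy [] G (.arr τ (.arr (.arr τ .unit) .unit))) :
    HasTy [] (iterateTm G) (.arr natTy (.arr τ (.arr (.arr τ .unit) .unit))) := by
  repeat' first | exact hG.weaken _ | apply HasTy.caseNat | constructor

theorem onlyExc_iterateTm {G : Tm} (hG : G.OnlyExc natTy) : (iterateTm G).OnlyExc natTy := by
  simp [iterateTm, Tm.OnlyExc, hG]

theorem run_iterateTm {G k : Tm} (hG : G.Closed) (hT : (iterateTm G).Closed) (n : ℕ) (b : β)
    (hk : k.IsValue) (hkc : k.Closed) :
    Run ret (iterateTm G (tm n) (tm b) k) (.caseNat (tm n) (k (tm b))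
      (G (tm b) (.lam (iterateTm G (.var 1) (.var 0) k)))) :=
  ((((Run.unfold (N := iterateTm G) rfl).appL _).appL _).appL _).trans <|
    .beta₃ (isValue n) (isValue b) hk (by
      simp [hG.subst_eq, hT.subst_eq, hT.rename_eq, hkc.rename_eq])

namespace Definable

theorem const (b : β) : Definable ret fun _ : α => b :=
  ⟨.lam (.lam (Tm.var 0 (tm b))),
    .lam _ _ _ _ (.lam _ _ _ _ (.app _ _ _ _ _ (.var _ _ _ rfl) ((hasTy b).weaken _))),
    ⟨trivial, onlyExc b⟩,
    fun a _ hk _ => (Run.beta₂ (isValue a) hk (by simp)).yields⟩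

theorem succ : Definable ret Nat.succ :=
  ⟨.lam (.lam (Tm.var 0 (.lam (.raise natTy (.var 2))))),
    .lam _ _ _ _ (.lam _ _ _ _ (.app _ natTy _ _ _ (.var _ _ _ rfl)
      (.lam _ _ _ _ (.raise _ _ _ _ (.var _ _ _ rfl))))),
    ⟨trivial, rfl, trivial⟩,
    fun n _ hk _ => (Run.beta₂ (isValue n) hk (by simp [tm_succ])).yields⟩

theorem comp {g : β → γ} {f : α → β} (hg : Definable ret g) (hf : Definable ret f) :
    Definable ret fun a => g (f a) := by
  obtain ⟨G, hG⟩ := hg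
  obtain ⟨F, hF⟩ := hf
  refine ⟨.lam (.lam (F (.var 1) (.lam (G (.var 0) (.var 1))))), ?_, ?_, fun a k hk hkc => ?_⟩
  · repeat' first | exact hF.hasTy.weaken _ | exact hG.hasTy.weaken _ | constructor
  · exact ⟨⟨hF.onlyExc, trivial⟩, ⟨hG.onlyExc, trivial⟩, trivial⟩
  · calc
      Run ret _ (F (tm a) (.lam (G (.var 0) k))) := .beta₂ (isValue a) hk (by
        simp [hF.closed.subst_eq, hG.closed.subst_eq, hkc.rename_eq])
      Yields ret _ (Tm.lam (G (.var 0) k) (tm (f a))) := hF.yields a trivial fun s => by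
        simp [hG.closed.subst_eq, hkc.subst_eq]
      Run ret _ (G (tm (f a)) k) := .beta (isValue _) (by
        simp [hG.closed.subst_eq, hkc.subst_eq])
      Yields ret _ (k (tm (g (f a)))) := hG.yields _ hk hkc

theorem uncurry {T : Tm} {f : α → β → γ}
    (hT : HasTy [] T (.arr (ty α) (.arr (ty β) (.arr (.arr (ty γ) .unit) .unit))))
    (hT' : T.OnlyExc natTy)
    (h : ∀ a b {k : Tm}, k.IsValue → k.Closed → Yields ret (T (tm a) (tm b) k) (k (tm (f a b)))) :
    Definable ret fun p : α × β => f p.1 p.2 := by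
  refine ⟨.lam (.lam (Tm.var 1 (.lam (.lam (T (.var 1) (.var 0) (.var 2)))))), ?_, ?_,
    fun p k hk hkc => ?_⟩
  · repeat' first | exact hT.weaken _ | constructor
  · exact ⟨trivial, ⟨⟨hT', trivial⟩, trivial⟩, trivial⟩
  · calc
      Run ret _ (tm p (.lam (.lam (T (.var 1) (.var 0) k)))) := .beta₂ (isValue p) hk (by
        simp [hT.closed.subst_eq, hkc.rename_eq])
      Run ret _ (Tm.lam (.lam (T (.var 1) (.var 0) k)) (tm p.1) (tm p.2)) := .beta trivial (by
        simp)
      Run ret _ (T (tm p.1) (tm p.2) k) := .beta₂ (isValue _) (isValue _) (by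
        simp [hT.closed.subst_eq, hkc.subst_eq])
      Yields ret _ (k (tm (f p.1 p.2))) := h _ _ hk hkc

theorem fst : Definable ret (Prod.fst : α × β → α) :=
  uncurry (f := fun a _ => a) (T := .lam (.lam (.lam (Tm.var 0 (.var 2)))))
    (by repeat' constructor) ⟨trivial, trivial⟩
    fun a b _ hk _ => (Run.beta₃ (isValue a) (isValue b) hk (by simp)).yields

theorem snd : Definable ret (Prod.snd : α × β → β) :=
  uncurry (f := fun _ b => b) (T := .lam (.lam (.lam (Tm.var 0 (.var 1)))))
    (by repeat' constructor) ⟨trivial, trivial⟩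
    fun a b _ hk _ => (Run.beta₃ (isValue a) (isValue b) hk (by simp)).yields

theorem prod {f : α → β} {g : α → γ} (hf : Definable ret f) (hg : Definable ret g) :
    Definable ret fun a => (f a, g a) := by
  obtain ⟨F, hF⟩ := hf
  obtain ⟨G, hG⟩ := hg
  refine ⟨.lam (.lam (F (.var 1) (.lam (G (.var 2) (.lam
    (Tm.var 2 (.lam (Tm.var 0 (.var 2) (.var 1))))))))), ?_, ?_, fun a k hk hkc => ?_⟩
  · repeat' first | exact hF.hasTy.weaken _ | exact hG.hasTy.weaken _ | constructor
  · exact ⟨⟨hF.onlyExc, trivial⟩, ⟨hG.onlyExc, trivial⟩, trivial, ⟨trivial, trivial⟩, trivial⟩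
  · calc
      Run ret _ (F (tm a) (.lam (G (tm a) (.lam (k (.lam (Tm.var 0 (.var 2) (.var 1)))))))) :=
        .beta₂ (isValue a) hk (by
          simp [hF.closed.subst_eq, hG.closed.subst_eq, hkc.rename_eq])
      Yields ret _ (Tm.lam (G (tm a) (.lam (k (.lam (Tm.var 0 (.var 2) (.var 1)))))) (tm (f a))) :=
        hF.yields a trivial fun s => by simp [hG.closed.subst_eq, hkc.subst_eq]
      Run ret _ (G (tm a) (.lam (k (.lam (Tm.var 0 (tm (f a)) (.var 1)))))) :=
        .beta (isValue _) (by simp [hG.closed.subst_eq, hkc.subst_eq])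
      Yields ret _ (Tm.lam (k (.lam (Tm.var 0 (tm (f a)) (.var 1)))) (tm (g a))) :=
        hG.yields a trivial fun s => by simp [hkc.subst_eq]
      Run ret _ (k (tm (f a, g a))) := .beta (isValue _) (by
        simp [hkc.subst_eq, tm_prod])

theorem iterate {g : β → β} (hg : Definable ret g) :
    Definable ret fun p : ℕ × β => g^[p.1] p.2 := by
  obtain ⟨G, hG⟩ := hg
  have hT : (iterateTm G).Closed := (hasTy_iterateTm hG.hasTy).closed
  refine uncurry (hasTy_iterateTm hG.hasTy) (onlyExc_iterateTm hG.onlyExc) fun n b k hk hkc => ?_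
  induction n generalizing b with
  | zero =>
    calc
      Run ret _ _ := run_iterateTm hG.closed hT 0 b hk hkc
      Yields ret _ (k (tm b)) := .caseNat_zero (by simp [hkc.subst_eq])
  | succ n ih =>
    calc
      Run ret _ _ := run_iterateTm hG.closed hT (n + 1) b hk hkc
      Run ret _ (G (tm b) (.lam (iterateTm G (tm n) (.var 0) k))) := .caseNat_succ n (by
        simp [hG.closed.subst_eq, hT.subst_eq, hkc.subst_eq])
      Yields ret _ (Tm.lam (iterateTm G (tm n) (.var 0) k) (tm (g b))) :=
        hG.yields b trivial fun s => by simp [hT.subst_eq, hkc.subst_eq]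
      Run ret _ (iterateTm G (tm n) (tm (g b)) k) := .beta (isValue _) (by
        simp [hT.subst_eq, hkc.subst_eq])
      Yields ret _ (k (tm (g^[n] (g b)))) := ih (g b)

theorem natRec {f : α → β} {g : ℕ × β × α → β} (hf : Definable ret f) (hg : Definable ret g) :
    Definable ret fun p : ℕ × α => (p.1.rec (f p.2) fun y IH => g (y, IH, p.2) : β) := by
  let step (s : ℕ × β × α) : ℕ × β × α := (s.1 + 1, g s, s.2.2)
  have iterate_step (n : ℕ) (a : α) :
      step^[n] (0, f a, a) = (n, n.rec (f a) fun y IH => g (y, IH, a), a) := by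
    induction n with
    | zero => rfl
    | succ n ih => rw [Function.iterate_succ_apply', ih]
  have hstep : Definable ret step := (succ.comp fst).prod (hg.prod (snd.comp snd))
  have hstart : Definable ret fun p : ℕ × α => (p.1, 0, f p.2, p.2) :=
    fst.prod ((const 0).prod ((hf.comp snd).prod snd))
  simpa only [iterate_step] using fst.comp (snd.comp (hstep.iterate.comp hstart))

theorem vector_cons {n : ℕ} {f : α → ℕ} {g : α → List.Vector ℕ n} (hf : Definable ret f)
    (hg : Definable ret g) : Definable ret fun a => f a ::ᵥ g a :=
  let ⟨T, hT⟩ := hf.prod hg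
  ⟨T, hT.hasTy, hT.onlyExc, hT.yields⟩

theorem of_vector_uncons {n : ℕ} {f : ℕ × List.Vector ℕ n → α} (hf : Definable ret f) :
    Definable ret fun v : List.Vector ℕ (n + 1) => f (v.head, v.tail) :=
  let ⟨T, hT⟩ := hf
  ⟨T, hT.hasTy, hT.onlyExc, fun v => hT.yields (v.head, v.tail)⟩

theorem vector_get : ∀ {n : ℕ} (i : Fin n), Definable ret fun v : List.Vector ℕ n => v.get i
  | _ + 1, i => by
    cases i using Fin.cases with
    | zero => simpa only [List.Vector.get_zero] using fst.of_vector_uncons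
    | succ i =>
      simpa only [List.Vector.get_tail_succ] using ((vector_get i).comp snd).of_vector_uncons

theorem vector_ofFn : ∀ {n : ℕ} {f : Fin n → α → ℕ}, (∀ i, Definable ret (f i)) →
    Definable ret fun a => List.Vector.ofFn fun i => f i a
  | 0, _, _ => const List.Vector.nil
  | _ + 1, _, hf => (hf 0).vector_cons (vector_ofFn fun i => hf i.succ)

theorem of_primrec' {n : ℕ} {f : List.Vector ℕ n → ℕ} (hf : Nat.Primrec' f) : Definable ret f := by
  induction hf with
  | zero => exact const 0
  | succ => exact (succ.comp fst).of_vector_uncons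
  | get i => exact vector_get i
  | comp g _ _ ihf ihg => exact ihf.comp (vector_ofFn ihg)
  | @prec n f g _ _ ihf ihg =>
    have hcons : Definable ret fun s : ℕ × ℕ × List.Vector ℕ n => s.1 ::ᵥ s.2.1 ::ᵥ s.2.2 :=
      fst.vector_cons ((fst.comp snd).vector_cons (snd.comp snd))
    exact (natRec ihf (ihg.comp hcons)).of_vector_uncons

theorem of_primrec₂ {f : ℕ → ℕ → ℕ} (hf : Primrec₂ f) :
    Definable ret fun p : ℕ × ℕ => f p.1 p.2 :=
  (of_primrec' (Nat.Primrec'.prim_iff₂.2 hf)).comp (fst.vector_cons (snd.vector_cons (const .nil)))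

end Definable

/-! ### Unbounded search -/

/-- The function `search a := T a (λ y. case y of 0 → G a search | m + 1 → fail)`. If `G` and `T`
compute `g` and `t`, it iterates `g` until it finds a point where `t` does not vanish. -/
def searchTm (G T : Tm) : Tm :=
  .fix (T (.var 0) (.lam ((Tm.var 0).caseNat (G (.var 2) (.lam (Tm.var 4 (.var 0)))) .fail)))

theorem hasTy_searchTm {G T : Tm} {τ : Ty} (hG : HasTy [] G (.arr τ (.arr (.arr τ .unit) .unit)))
    (hT : HasTy [] T (.arr τ (.arr (.arr natTy .unit) .unit))) :
    HasTy [] (searchTm G T) (.arr τ .unit) := by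
  repeat' first | exact hG.weaken _ | exact hT.weaken _ | apply HasTy.caseNat | constructor

theorem onlyExc_searchTm {G T : Tm} (hG : G.OnlyExc natTy) (hT : T.OnlyExc natTy) :
    (searchTm G T).OnlyExc natTy := by
  simp [searchTm, Tm.OnlyExc, hG, hT]

section Search

variable {G T : Tm} {g : α → α} {t : α → ℕ}

theorem yields_searchTm (hG : Computes ret G g) (hT : Computes ret T t) (a : α) :
    Yields ret (searchTm G T (tm a))
      (.caseNat (tm (t a)) (G (tm a) (.lam (searchTm G T (.var 0)))) .fail) := by
  have hS : (searchTm G T).Closed := (hasTy_searchTm hG.hasTy hT.hasTy).closed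
  let k : Tm := .lam ((Tm.var 0).caseNat (G (tm a) (.lam (searchTm G T (.var 0)))) .fail)
  have hk : k.Closed := fun s => by simp [k, hG.closed.subst_eq, hS.subst_eq]
  calc
    Run ret _ (T (tm a) k) :=
      ((Run.unfold (N := searchTm G T) rfl).appL _).trans <| .beta (isValue a) (by
        simp [k, hT.closed.subst_eq, hG.closed.subst_eq, hS.rename_eq, hS.subst_eq])
    Yields ret _ (k (tm (t a))) := hT.yields a trivial hk
    Run ret _ (.caseNat (tm (t a)) (G (tm a) (.lam (searchTm G T (.var 0)))) .fail) :=
      .beta (isValue _) (by simp [hG.closed.subst_eq, hS.subst_eq])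

theorem yields_searchTm_next (hG : Computes ret G g) (hT : Computes ret T t) {a : α}
    (ha : t a = 0) : Yields ret (searchTm G T (tm a)) (searchTm G T (tm (g a))) := by
  have hS : (searchTm G T).Closed := (hasTy_searchTm hG.hasTy hT.hasTy).closed
  calc
    Yields ret _ (.caseNat (tm 0) (G (tm a) (.lam (searchTm G T (.var 0)))) .fail) :=
      ha ▸ yields_searchTm hG hT a
    Yields ret _ (G (tm a) (.lam (searchTm G T (.var 0)))) := .caseNat_zero (by
      simp [hG.closed.subst_eq, hS.subst_eq])
    Yields ret _ (Tm.lam (searchTm G T (.var 0)) (tm (g a))) := hG.yields a trivial fun s => by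
      simp [hS.subst_eq]
    Run ret _ (searchTm G T (tm (g a))) := .beta (isValue _) (by simp [hS.subst_eq])

theorem yields_searchTm_fail (hG : Computes ret G g) (hT : Computes ret T t) {a : α}
    (ha : t a ≠ 0) : Yields ret (searchTm G T (tm a)) .fail := by
  obtain ⟨n, hn⟩ := Nat.exists_eq_add_one_of_ne_zero ha
  calc
    Yields ret _ (.caseNat (tm (n + 1)) (G (tm a) (.lam (searchTm G T (.var 0)))) .fail) :=
      hn ▸ yields_searchTm hG hT a
    Run ret _ .fail := .caseNat_succ n rfl

theorem reachesFail_searchTm_iff (hG : Computes ret G g) (hT : Computes ret T t) (a : α) :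
    ReachesFail ret (searchTm G T (tm a)) ↔ ∃ i, t (g^[i] a) ≠ 0 := by
  constructor
  · contrapose!
    intro h hfail
    let P (M : Tm) : Prop := ∃ (E : ECtx) (i : ℕ), E.plug (searchTm G T (tm (g^[i] a))) = M
    have progress : ∀ M, P M → ∃ N, P N ∧ TransGen (Step ret) M N := by
      rintro _ ⟨E, i, rfl⟩
      obtain ⟨C, hC⟩ := yields_searchTm_next hG hT (h i)
      rw [← Function.iterate_succ_apply' g] at hC
      exact ⟨_, ⟨E.comp C, i + 1, E.plug_comp C _⟩, hC E⟩
    obtain ⟨M, ⟨E, i, rfl⟩, hM⟩ :=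
      exists_reflTransGen_of_progress step_rightUnique progress ⟨.hole, 0, rfl⟩ hfail
    cases ECtx.eq_fail_of_plug_eq_fail (eq_fail_of_reflTransGen hM)
  · rintro ⟨i, hi⟩
    suffices Yields ret (searchTm G T (tm a)) .fail from this.reachesFail
    induction i generalizing a with
    | zero => exact yields_searchTm_fail hG hT hi
    | succ i ih =>
      by_cases ha : t a = 0
      · exact (yields_searchTm_next hG hT ha).trans (ih (g a) hi)
      · exact yields_searchTm_fail hG hT ha

end Search

/-! ### Undecidability -/

theorem primrec_lam : Primrec Tm.lam :=
  Primrec.encode_iff.1 <| (Primrec.nat_add.comp (Primrec.nat_mul.comp (.const 7) .encode)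
    (.const 5)).of_eq fun _ => rfl

theorem primrec_app : Primrec₂ Tm.app :=
  Primrec.encode_iff.1 <| (Primrec.nat_add.comp (Primrec.nat_mul.comp (.const 7)
    (Primrec₂.natPair.comp (Primrec.encode.comp .fst) (Primrec.encode.comp .snd)))
    (.const 6)).of_eq fun _ => rfl

theorem primrec_raise (σ : Ty) : Primrec (Tm.raise σ) :=
  Primrec.encode_iff.1 <| (Primrec.nat_add.comp (Primrec.nat_mul.comp (.const 7)
    (Primrec₂.natPair.comp (.const σ.code) .encode)) (.const 9)).of_eq fun _ => rfl

theorem primrec_num : Primrec num :=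
  (Primrec.nat_rec₁ (num 0) ((primrec_lam.comp (primrec_raise natTy)).comp .snd).to₂).of_eq
    fun n => by
      induction n with
      | zero => rfl
      | succ n ih => simp only [num, ← ih]

theorem exists_primrec_reachesFail_iff {f : ℕ → ℕ → ℕ} (hf : Primrec₂ f) :
    ∃ P : ℕ → Tm, Primrec P ∧
      ∀ n, IsProgram (P n) ∧ (P n).OnlyExc natTy ∧ (ReachesFail ret (P n) ↔ ∃ k, f n k ≠ 0) := by
  let g (p : ℕ × ℕ) : ℕ × ℕ := (p.1, p.2 + 1)
  have iterate_g (n k : ℕ) : g^[k] (n, 0) = (n, k) := by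
    induction k with
    | zero => rfl
    | succ k ih => rw [Function.iterate_succ_apply', ih]
  obtain ⟨G, hG⟩ : Definable ret g := Definable.fst.prod (Definable.succ.comp .snd)
  obtain ⟨T, hT⟩ := Definable.of_primrec₂ (ret := ret) hf
  refine ⟨fun n => searchTm G T (tm (n, 0)), ?_, fun n => ⟨?_, ?_, ?_⟩⟩
  · exact primrec_app.comp (.const _) (primrec_lam.comp (primrec_app.comp
      (primrec_app.comp (.const (Tm.var 0)) primrec_num) (.const (num 0))))
  · exact ⟨.unit, trivial, .app _ _ _ _ _ (hasTy_searchTm hG.hasTy hT.hasTy) (hasTy (n, 0))⟩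
  · exact ⟨onlyExc_searchTm hG.onlyExc hT.onlyExc, onlyExc (n, 0)⟩
  · simp only [reachesFail_searchTm_iff hG hT, iterate_g]

theorem exists_primrec₂_ne_zero_iff_halts :
    ∃ f : ℕ → ℕ → ℕ, Primrec₂ f ∧
      ∀ c : Nat.Partrec.Code, (∃ k, f (Encodable.encode c) k ≠ 0) ↔ (c.eval 0).Dom := by
  refine ⟨fun n k => Encodable.encode (Nat.Partrec.Code.evaln k (Denumerable.ofNat _ n) 0),
    Primrec.encode.comp (Nat.Partrec.Code.primrec_evaln.comp
      ((Primrec.snd.pair ((Primrec.ofNat _).comp .fst)).pair (.const 0))), fun c => ?_⟩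
  have encode_ne_zero (o : Option ℕ) : Encodable.encode o ≠ 0 ↔ ∃ x, x ∈ o := by
    cases o <;> simp
  simp only [encode_ne_zero, Denumerable.ofNat_encode, Part.dom_iff_mem,
    Nat.Partrec.Code.evaln_complete]
  exact exists_comm

theorem DecidableProblem.mono {α : Type} [Primcodable α] {D D' R : α → Prop}
    (h : DecidableProblem D R) (hD : ∀ a, D' a → D a) : DecidableProblem D' R :=
  let ⟨p, hp, hpR⟩ := h
  ⟨p, hp, fun a ha => hpR a (hD a ha)⟩

theorem DecidableProblem.computablePred_comp {α β : Type} [Primcodable α] [Primcodable β]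
    {D R : β → Prop} (h : DecidableProblem D R) {f : α → β} (hf : Computable f)
    (hD : ∀ a, D (f a)) : ComputablePred fun a => R (f a) :=
  let ⟨_, hp, hpR⟩ := h
  ComputablePred.computable_of_manyOneReducible ⟨f, hf, fun a => (hpR _ (hD a)).symm⟩ hp

theorem not_decidableProblem_reachesFail_onlyExc :
    ¬ DecidableProblem (fun M => IsProgram M ∧ M.OnlyExc natTy) (ReachesFail ret) := by
  intro h
  obtain ⟨f, hf, hfc⟩ := exists_primrec₂_ne_zero_iff_halts
  obtain ⟨P, hP, hPf⟩ := exists_primrec_reachesFail_iff (ret := ret) hf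
  have reduction : Computable fun c : Nat.Partrec.Code => P (Encodable.encode c) :=
    hP.to_comp.comp .encode
  refine ComputablePred.halting_problem 0 ?_
  simpa only [(hPf _).2.2, hfc] using
    h.computablePred_comp reduction fun _ => ⟨(hPf _).1, (hPf _).2.1⟩

end BPCF

theorem mainTheorem5 (ret : Bool) :
    ¬ BPCF.DecidableProblem BPCF.IsProgram (BPCF.ReachesFail ret) ∧
    ¬ BPCF.DecidableProblem
        (fun M => BPCF.IsProgram M ∧ M.OnlyExc (BPCF.Ty.arr BPCF.Ty.unit BPCF.Ty.unit))
        (BPCF.ReachesFail ret) := by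
  have restricted := BPCF.not_decidableProblem_reachesFail_onlyExc (ret := ret)
  exact ⟨fun h => restricted (h.mono fun _ hM => hM.1), restricted⟩
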